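/- Let $V$ be a finite-dimensional Euclidean space and $R\subset V\setminus\{0\}$ a finite reduced root system: $\sigma_\alpha(R)=R$ and $R\cap\mathbb R\alpha=\{\pm\alpha\}$ for all $\alpha\in R$, where $\sigma_\alpha$ is the orthogonal reflection in the hyperplane $\alpha^\perp$ (neither a crystallographic nor a spanning condition is imposed). Let $G$ be the finite group generated by the $\sigma_\alpha$, $\alpha\in R$, with identity $e$; let $\beta\in V$ satisfy $\langle\alpha,\beta\rangle\neq0$ for all $\alpha\in R$ and put $R_+=\{\alpha\in R:\langle\alpha,\beta\rangle>0\}$. Let $k:R\to\mathbb C$ be $G$-invariant, and set $\gamma=\sum_{\alpha\in R_+}k(\alpha)$ and $\delta=\sum_{\alpha\in R_+}|k(\alpha)|$. Let $\mathcal P_n$ be the space of complex-valued homogeneous polynomials of degree $n$ on $V$, $\mathcal P=\bigoplus_{n\ge0}\mathcal P_n$, let $G$ act by $(g\cdot f)(x)=f(gx)$, and let $A_n$ be the endomorphism $\sum_{\alpha\in R_+}k(\alpha)\,\sigma_\alpha$ of $\mathcal P_n$. For $\xi\in V$ let $\partial_\xi$ be the directional derivative and $$T_\xi f(x)=\partial_\xi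 f(x)+\sum_{\alpha\in R_+}k(\alpha)\langle\alpha,\xi\rangle\frac{f(x)-f(\sigma_\alpha x)}{\langle\alpha,x\rangle}$$ the Dunkl operator (the quotients being extended continuously to the hyperplanes $\langle\alpha,x\rangle=0$). A Dunkl intertwining operator is a linear isomorphism $V_k$ of $\mathcal P$ such that $V_k(\mathcal P_n)\subset\mathcal P_n$ for all $n$, $V_k(1)=1$ and $T_\xi V_k=V_k\partial_\xi$ for all $\xi\in V$. For $g\in G$ put $c_0(g)=1$ if $g=e$ and $c_0(g)=0$ otherwise, and for $m\ge1$ $$c_m(g)=\sum_{\substack{(\alpha_1,\dots,\alpha_m)\in R_+^m\\ \sigma_{\alpha_1}\cdots\sigma_{\alpha_m}=g}}k(\alpha_1)\cdots k(\alpha_m);$$ for $n\ge1$ put $$C_n(g)=\sum_{m=0}^{\infty}\frac{c_m(g)}{(n+\gamma)^{m+1}} .$$ Assume $\delta<|1+\gamma|$. Then, for every $n\ge1$: (1) the series defining $C_n(g)$ converges absolutely for every $g\in G$, the endomorphism $(n+\gamma)-A_n$ of $\mathcal P_n$ is invertible, and its inverse $H_n$ is $$H_n=\sum_{g\in G}C_n(g)\,g\qquad\text{on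 }\mathcal P_n;$$ (2) there is exactly one Dunkl intertwining operator $V_k$, and for all $p\in\mathcal P_n$ and $x\in V$ $$V_k(p)(x)=\sum_{g_1,\dots,g_n\in G}C(g_1,\dots,g_n)\,\partial_{g_1x}\partial_{g_2x}\cdots\partial_{g_nx}\,p ,$$ where $C(g_1,\dots,g_n)=C_n(g_n)\,C_{n-1}(g_n^{-1}g_{n-1})\cdots C_1(g_2^{-1}g_1)$ and the constant polynomial $\partial_{g_1x}\cdots\partial_{g_nx}p$ is identified with its value. -/

import Mathlib

open scoped InnerProductSpace

noncomputable section

namespace Dunkl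

variable {V : Type*} [NormedAddCommGroup V] [InnerProductSpace ℝ V]

/-! ### Root systems and reflection groups -/

/-- The orthogonal reflection `σ_α` with respect to the hyperplane `α^⊥`. -/
def refl (α : V) : V ≃ₗᵢ[ℝ] V := (ℝ ∙ α)ᗮ.reflection

theorem refl_apply (α x : V) : refl α x = x - (2 * (⟪α, x⟫_ℝ / ⟪α, α⟫_ℝ)) • α := by
  rw [refl, Submodule.reflection_orthogonal_apply, Submodule.reflection_singleton_apply]
  simp only [neg_sub, real_inner_self_eq_norm_sq, mul_smul, two_smul, RCLike.ofReal_real_eq_id,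
    id_eq]

variable (V) in
/-- A reduced (not necessarily crystallographic, not necessarily spanning) root system in the
Euclidean space `V`. -/
structure ReducedRootSystem where
  /-- the finite set `R` of roots -/
  roots : Finset V
  ne_zero : ∀ α ∈ roots, α ≠ 0
  refl_image : ∀ α ∈ roots, refl α '' (roots : Set V) = roots
  reduced : ∀ α ∈ roots, (roots : Set V) ∩ (ℝ ∙ α) = {α, -α}

namespace ReducedRootSystem

/-- The reflection group: the group generated by the reflections `σ_α`, `α ∈ R`. -/
def group (R : ReducedRootSystem V) : Subgroup (V ≃ₗᵢ[ℝ] V) :=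
  Subgroup.closure (refl '' (R.roots : Set V))

open Classical in
/-- The positive system `R₊ = {α ∈ R : ⟨α, β⟩ > 0}`. -/
def positive (R : ReducedRootSystem V) (β : V) : Finset V :=
  R.roots.filter fun α => 0 < ⟪α, β⟫_ℝ

theorem group_action (R : ReducedRootSystem V) {g : V ≃ₗᵢ[ℝ] V} (hg : g ∈ R.group) :
    (∀ α ∈ R.roots, g α ∈ R.roots) ∧ ∀ x ∈ (Submodule.span ℝ (R.roots : Set V))ᗮ, g x = x := by
  have hR : ∀ α ∈ R.roots, ∀ β ∈ R.roots, refl α β ∈ R.roots := fun α hα β hβ => by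
    have h : refl α β ∈ refl α '' (R.roots : Set V) := ⟨β, hβ, rfl⟩
    rw [R.refl_image α hα] at h
    exact h
  induction hg using Subgroup.closure_induction'' with
  | mem x hx =>
    obtain ⟨α, hα, rfl⟩ := hx
    refine ⟨hR α hα, fun x hx => ?_⟩
    rw [refl_apply, (Submodule.mem_orthogonal _ _).1 hx α (Submodule.subset_span hα)]
    simp
  | inv_mem x hx =>
    obtain ⟨α, hα, rfl⟩ := hx
    have : (refl α)⁻¹ = refl α := Submodule.reflection_symm
    rw [this]
    refine ⟨hR α hα, fun x hx => ?_⟩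
    rw [refl_apply, (Submodule.mem_orthogonal _ _).1 hx α (Submodule.subset_span hα)]
    simp
  | one => exact ⟨fun α hα => hα, fun x _ => rfl⟩
  | mul x y _ _ hx hy =>
    refine ⟨fun α hα => hx.1 _ (hy.1 α hα), fun v hv => ?_⟩
    change x (y v) = v
    rw [hy.2 v hv, hx.2 v hv]

/-- The reflection group of a root system is finite. -/
instance finite_group [FiniteDimensional ℝ V] (R : ReducedRootSystem V) : Finite R.group := by
  let f : R.group → (R.roots → R.roots) := fun g α =>
    ⟨(g : V ≃ₗᵢ[ℝ] V) α, (R.group_action g.2).1 α α.2⟩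
  refine Finite.of_injective f fun g h hgh => ?_
  have h1 : ∀ x ∈ Submodule.span ℝ (R.roots : Set V),
      (g : V ≃ₗᵢ[ℝ] V) x = (h : V ≃ₗᵢ[ℝ] V) x := by
    intro x hx
    induction hx using Submodule.span_induction with
    | mem x hx => exact congrArg Subtype.val (congrFun hgh ⟨x, hx⟩)
    | zero => simp
    | add x y _ _ hx hy => simp [hx, hy]
    | smul a x _ hx => simp [hx]
  apply Subtype.ext
  ext x
  obtain ⟨y, hy, z, hz, rfl⟩ :=
    (Submodule.span ℝ (R.roots : Set V)).exists_add_mem_mem_orthogonal x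
  rw [map_add, map_add, h1 y hy, (R.group_action g.2).2 z hz, (R.group_action h.2).2 z hz]

instance fintype_group [FiniteDimensional ℝ V] (R : ReducedRootSystem V) : Fintype R.group :=
  Fintype.ofFinite _

end ReducedRootSystem

/-- `k` is a multiplicity function, i.e. it is `G`-invariant on the roots
(its values outside `R` are never used). -/
def IsMultiplicity (R : ReducedRootSystem V) (k : V → ℂ) : Prop :=
  ∀ g ∈ R.group, ∀ α ∈ R.roots, k (g α) = k α

/-! ### Polynomials on `V` -/

variable (V) in
/-- The space `𝒫_n` of complex-valued homogeneous polynomials of degree `n` on `V`, i.e. of the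
functions `x ↦ M (x, …, x)` for an `n`-linear form `M`. (Continuity of `M` is
automatic when `V` is finite-dimensional.) -/
def homog (n : ℕ) : Submodule ℂ (V → ℂ) where
  carrier := {f | ∃ M : ContinuousMultilinearMap ℝ (fun _ : Fin n => V) ℂ,
    ∀ x, f x = M fun _ => x}
  zero_mem' := ⟨0, fun _ => rfl⟩
  add_mem' := by
    rintro f g ⟨M, hM⟩ ⟨N, hN⟩
    exact ⟨M + N, fun x => by simp [hM, hN]⟩
  smul_mem' := by
    rintro c f ⟨M, hM⟩
    exact ⟨c • M, fun x => by simp [hM]⟩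

variable (V) in
/-- The space `𝒫` of complex-valued polynomials on `V`, the sum of all the `𝒫_n`. -/
def poly : Submodule ℂ (V → ℂ) := ⨆ n, homog V n

theorem homog_le_poly (n : ℕ) : homog V n ≤ poly V := le_iSup (homog V) n

/-- The directional derivative `∂_ξ`. -/
def dirDeriv (ξ : V) (f : V → ℂ) : V → ℂ := fun x => fderiv ℝ f x ξ

theorem differentiable_of_mem_homog {n : ℕ} {f : V → ℂ} (hf : f ∈ homog V n) :
    Differentiable ℝ f := by
  obtain ⟨M, hM⟩ := hf
  obtain rfl : f = fun x => M fun _ => x := funext hM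
  intro x
  exact (M.hasFDerivAt _).differentiableAt.comp x
    (differentiableAt_pi.2 fun _ => differentiableAt_id)

theorem dirDeriv_mem_homog {n : ℕ} {f : V → ℂ} (hf : f ∈ homog V n) (ξ : V) :
    dirDeriv ξ f ∈ homog V (n - 1) := by
  obtain ⟨M, hM⟩ := hf
  obtain rfl : f = fun x => M fun _ => x := funext hM
  have key : ∀ x, dirDeriv ξ (fun x => M fun _ => x) x =
      ∑ i, M (Function.update (fun _ => x) i ξ) := by
    intro x
    have h : HasFDerivAt (fun x : V => M fun _ => x)
        ((M.linearDeriv fun _ => x).comp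
          (ContinuousLinearMap.pi fun _ => ContinuousLinearMap.id ℝ V)) x :=
      (M.hasFDerivAt (fun _ => x)).comp x (hasFDerivAt_pi.2 fun _ => hasFDerivAt_id x)
    rw [dirDeriv, h.fderiv]
    simp [ContinuousMultilinearMap.linearDeriv_apply]
  cases n with
  | zero => exact ⟨0, fun x => by simp [key]⟩
  | succ n =>
    refine ⟨∑ i, M.curryMid i ξ, fun x => ?_⟩
    rw [key, sum_apply]
    refine Finset.sum_congr rfl fun i _ => ?_
    rw [ContinuousMultilinearMap.curryMid_apply]
    congr 1
    ext j
    refine i.succAboveCases ?_ (fun j => ?_) j <;> simp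

theorem differentiable_of_mem_poly {f : V → ℂ} (hf : f ∈ poly V) : Differentiable ℝ f := by
  induction hf using Submodule.iSup_induction' with
  | mem n f hf => exact differentiable_of_mem_homog hf
  | zero => exact differentiable_const 0
  | add f g _ _ hf hg => exact hf.add hg

theorem dirDeriv_add (ξ : V) {f g : V → ℂ} (hf : Differentiable ℝ f) (hg : Differentiable ℝ g) :
    dirDeriv ξ (f + g) = dirDeriv ξ f + dirDeriv ξ g := by
  ext x
  simp [dirDeriv, fderiv_add (hf x) (hg x)]

theorem dirDeriv_mem_poly (ξ : V) {f : V → ℂ} (hf : f ∈ poly V) : dirDeriv ξ f ∈ poly V := by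
  induction hf using Submodule.iSup_induction' with
  | mem n f hf => exact homog_le_poly _ (dirDeriv_mem_homog hf ξ)
  | zero =>
    have : dirDeriv ξ (0 : V → ℂ) = 0 := by
      ext x
      simp [dirDeriv]
    rw [this]
    exact zero_mem _
  | add f g hf' hg' hf hg =>
    rw [dirDeriv_add ξ (differentiable_of_mem_poly hf') (differentiable_of_mem_poly hg')]
    exact add_mem hf hg

/-- The directional derivative `∂_ξ p` of a polynomial `p`, as a polynomial. -/
def polyDeriv (ξ : V) (p : poly V) : poly V := ⟨dirDeriv ξ p, dirDeriv_mem_poly ξ p.2⟩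

variable (V) in
/-- The constant polynomial `1`. -/
def polyOne : poly V :=
  ⟨fun _ => 1, homog_le_poly 0 ⟨ContinuousMultilinearMap.constOfIsEmpty ℝ _ 1, fun _ => rfl⟩⟩

/-! ### Dunkl operators and the intertwining operator -/

/-- The divided difference `(f(x) - f(σ_α x)) / ⟨α, x⟩`. On the hyperplane `⟨α, x⟩ = 0` it is
extended by its limit `(2 / ⟨α, α⟩) ∂_α f(x)` (`f` differentiable near the hyperplane with
continuous derivative), as usual in the definition of the Dunkl operators. -/
def dividedDiff (α : V) (f : V → ℂ) (x : V) : ℂ :=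
  open Classical in
  if ⟪α, x⟫_ℝ = 0 then (2 / ⟪α, α⟫_ℝ : ℝ) * dirDeriv α f x
  else (f x - f (refl α x)) / (⟪α, x⟫_ℝ : ℝ)

/-- The Dunkl operator `T_ξ(k)` associated with the positive system `P = R₊`. -/
def dunklOp (P : Finset V) (k : V → ℂ) (ξ : V) (f : V → ℂ) : V → ℂ := fun x =>
  dirDeriv ξ f x + ∑ α ∈ P, k α * (⟪α, ξ⟫_ℝ : ℝ) * dividedDiff α f x

/-- The linear isomorphism `U` of `𝒫` is a Dunkl intertwining operator:
`U(𝒫_n) ⊂ 𝒫_n`, `U(1) = 1` and `T_ξ U = U ∂_ξ` for all `ξ`. -/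
structure IsDunklIntertwining (P : Finset V) (k : V → ℂ) (U : poly V ≃ₗ[ℂ] poly V) : Prop where
  map_homog : ∀ (n : ℕ) (p : poly V), (p : V → ℂ) ∈ homog V n → (U p : V → ℂ) ∈ homog V n
  map_one : U (polyOne V) = polyOne V
  intertwines : ∀ (ξ : V) (p : poly V),
    dunklOp P k ξ (U p : V → ℂ) = (U (polyDeriv ξ p) : V → ℂ)

/-! ### The resolvent -/

/-- The action `(g · f)(x) = f(g x)` on `𝒫_n`. -/
def act (n : ℕ) (g : V ≃ₗᵢ[ℝ] V) : Module.End ℂ (homog V n) where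
  toFun f := ⟨fun x => (f : V → ℂ) (g x), by
    obtain ⟨M, hM⟩ := f.2
    exact ⟨M.compContinuousLinearMap fun _ => (g : V →L[ℝ] V), fun x => by
      exact hM (g x)⟩⟩
  map_add' _ _ := rfl
  map_smul' _ _ := rfl

/-- `γ = ∑_{α ∈ R₊} k(α)`. -/
def gam (P : Finset V) (k : V → ℂ) : ℂ := ∑ α ∈ P, k α

/-- `δ = ∑_{α ∈ R₊} |k(α)|`. -/
def del (P : Finset V) (k : V → ℂ) : ℝ := ∑ α ∈ P, ‖k α‖

/-- `A_n`, the endomorphism of `𝒫_n` given by the action of `A = ∑_{α ∈ R₊} k(α) σ_α`. -/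
def opA (P : Finset V) (k : V → ℂ) (n : ℕ) : Module.End ℂ (homog V n) :=
  ∑ α ∈ P, k α • act n (refl α)

/-- The endomorphism `(n + γ) - A_n` of `𝒫_n`. -/
def shiftedA (P : Finset V) (k : V → ℂ) (n : ℕ) : Module.End ℂ (homog V n) :=
  ((n : ℂ) + gam P k) • (1 : Module.End ℂ (homog V n)) - opA P k n

/-- The resolvent `H_n = ((n + γ) - A_n)⁻¹` (meaningful when `shiftedA P k n` is a unit). -/
def resolventH (P : Finset V) (k : V → ℂ) (n : ℕ) : Module.End ℂ (homog V n) :=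
  Ring.inverse (shiftedA P k n)

open Classical in
/-- `c_m(g)`: the sum of `k(α_1) ⋯ k(α_m)` over all `(α_1, …, α_m) ∈ R₊^m` with
`σ_{α_1} ⋯ σ_{α_m} = g`; for `m = 0` the empty product gives `1` if `g = e` and `0` otherwise. -/
def cCoeff (P : Finset V) (k : V → ℂ) (m : ℕ) (g : V ≃ₗᵢ[ℝ] V) : ℂ :=
  ∑ a ∈ Fintype.piFinset fun _ : Fin m => P,
    if (List.ofFn fun i => refl (a i)).prod = g then ∏ i, k (a i) else 0

/-- The general term `c_m(g) / (n + γ)^(m + 1)` of the series defining `C_n(g)`. -/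
def cTerm (P : Finset V) (k : V → ℂ) (n : ℕ) (g : V ≃ₗᵢ[ℝ] V) (m : ℕ) : ℂ :=
  cCoeff P k m g / ((n : ℂ) + gam P k) ^ (m + 1)

/-- `C_n(g) = ∑_{m ≥ 0} c_m(g) / (n + γ)^(m + 1)`. -/
def bigC (P : Finset V) (k : V → ℂ) (n : ℕ) (g : V ≃ₗᵢ[ℝ] V) : ℂ := ∑' m, cTerm P k n g m

/-- `C(g_1, …, g_n) = C_n(g_n) C_{n-1}(g_n⁻¹ g_{n-1}) ⋯ C_1(g_2⁻¹ g_1)`, where `g_{i+1}` is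
written `g i` for `i = 0, …, n - 1`; the factor `i` is `C_{i+1}(g_{i+2}⁻¹ g_{i+1})`, with
`g_{n+1} = e`. -/
def multiC (P : Finset V) (k : V → ℂ) {n : ℕ} (g : Fin n → V ≃ₗᵢ[ℝ] V) : ℂ :=
  ∏ i : Fin n,
    bigC P k (i + 1) ((if h : (i : ℕ) + 1 < n then g ⟨i + 1, h⟩ else 1)⁻¹ * g i)

/-- The iterated directional derivative `∂_{ξ_1} ∂_{ξ_2} ⋯ ∂_{ξ_n} f`. -/
def iterDirDeriv {n : ℕ} (ξ : Fin n → V) (f : V → ℂ) : V → ℂ :=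
  (List.ofFn ξ).foldr dirDeriv f

end Dunkl

end

noncomputable section

namespace Dunkl

variable {V : Type*} [NormedAddCommGroup V] [InnerProductSpace ℝ V]

/-! ### Reflections and positive systems -/

/-! On `𝒫_n`, Euler's identity gives `T_x f(x) = (((n + γ) - A_n) f)(x)`
(`dunklOp_self_of_mem_homog`). Hence an intertwiner `U` must satisfy `((n + γ) - A_n)(U p)(x) =
U(∂_x p)(x)`. Since `δ < |1 + γ|` implies `δ < |n + γ|` for all `n ≥ 1`, the operator on the left is
inverted by a Neumann series whose coefficients, collected by group element, are the `C_n(g)`. So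
`U` on `𝒫_n` is determined by `U` on `𝒫_{n-1}`; unrolling this recursion gives uniqueness and the
formula, where conjugation invariance of `C_n` puts the coefficients into the form `multiC`.

For existence, the recursion is taken as the definition (`homogIntertwiner`). Let `f` be the image
of `p` of degree `n + 1`, let `q_ξ` be the image of `∂_ξ p`, and let `z = n + 1 + γ`. By induction
`T_ξ q_η = T_η q_ξ`, both being the image of `∂_ξ ∂_η p`. A Leibniz rule then computes `T_ξ` of `x ↦
q_x(x)` (`dunklOp_diagonal`), while equivariance of the Dunkl operators (`dunklOp_comp`) computes
`T_ξ` of `(z - A) f`, which is the same polynomial. Comparison shows that `D_ξ = T_ξ f - q_ξ`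
satisfies `z D_ξ(x) = ∑ k(α) D_{σ_α ξ}(σ_α x)`, and a maximum argument on the finite group with `δ <
|z|` forces `D = 0`. Commutativity of the Dunkl operators is not needed. -/

theorem refl_inv (α : V) : (refl α)⁻¹ = refl α := Submodule.reflection_symm

theorem refl_mul_self (α : V) : refl α * refl α = 1 := by
  nth_rewrite 1 [← refl_inv α]
  exact inv_mul_cancel _

theorem refl_neg (α : V) : refl (-α) = refl α := by
  ext x
  simp [refl_apply, neg_div]

theorem refl_self (α : V) : refl α α = -α := by
  by_cases h : α = 0
  · simp [h]
  · rw [refl_apply, div_self (inner_self_ne_zero.2 h)]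
    module

theorem refl_map (g : V ≃ₗᵢ[ℝ] V) (α x : V) : refl (g α) (g x) = g (refl α x) := by
  simp [refl_apply]

theorem refl_map_eq_conj (g : V ≃ₗᵢ[ℝ] V) (α : V) : refl (g α) = g * refl α * g⁻¹ := by
  ext x
  obtain ⟨y, rfl⟩ := g.surjective x
  rw [refl_map]
  change _ = g (refl α (g.symm (g y)))
  simp

theorem refl_eq_self {α x : V} (h : ⟪α, x⟫_ℝ = 0) : refl α x = x := by
  simp [refl_apply, h]

namespace ReducedRootSystem

variable (R : ReducedRootSystem V)

theorem refl_mem_group {α : V} (hα : α ∈ R.roots) : refl α ∈ R.group :=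
  Subgroup.subset_closure ⟨α, hα, rfl⟩

theorem neg_mem {α : V} (hα : α ∈ R.roots) : -α ∈ R.roots := by
  rw [← refl_self]
  exact (R.group_action (R.refl_mem_group hα)).1 α hα

theorem mem_positive {β α : V} : α ∈ R.positive β ↔ α ∈ R.roots ∧ 0 < ⟪α, β⟫_ℝ := by
  simp [positive]

theorem mem_roots_of_mem_positive {β α : V} (h : α ∈ R.positive β) : α ∈ R.roots :=
  (R.mem_positive.1 h).1

theorem sum_roots_eq_two_smul_sum_positive {β : V} (hβ : ∀ α ∈ R.roots, ⟪α, β⟫_ℝ ≠ 0)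
    (S : V → ℂ) (hS : ∀ α ∈ R.roots, S (-α) = S α) :
    ∑ α ∈ R.roots, S α = 2 * ∑ α ∈ R.positive β, S α := by
  classical
  have h : ∑ α ∈ R.roots.filter (fun α => ¬ 0 < ⟪α, β⟫_ℝ), S α = ∑ α ∈ R.positive β, S α := by
    refine Finset.sum_bij' (fun α _ => -α) (fun α _ => -α) ?_ ?_ (by simp) (by simp) ?_
    · intro α hα
      rw [Finset.mem_filter] at hα
      refine R.mem_positive.2 ⟨R.neg_mem hα.1, ?_⟩
      rw [inner_neg_left]
      have := lt_of_le_of_ne (not_lt.1 hα.2) (hβ α hα.1)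
      linarith
    · intro α hα
      rw [R.mem_positive] at hα
      rw [Finset.mem_filter, inner_neg_left]
      exact ⟨R.neg_mem hα.1, by linarith [hα.2]⟩
    · intro α hα
      exact (hS α (Finset.mem_filter.1 hα).1).symm
  rw [← Finset.sum_filter_add_sum_filter_not R.roots (fun α => 0 < ⟪α, β⟫_ℝ), h, two_mul]
  congr 1

/-- Sums over a positive system of an even function are invariant under the group. -/
theorem sum_positive_map {β : V} (hβ : ∀ α ∈ R.roots, ⟪α, β⟫_ℝ ≠ 0)
    {g : V ≃ₗᵢ[ℝ] V} (hg : g ∈ R.group) (S : V → ℂ) (hS : ∀ α ∈ R.roots, S (-α) = S α) :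
    ∑ α ∈ R.positive β, S (g α) = ∑ α ∈ R.positive β, S α := by
  -- Each sum is half of a sum over all of `R`, which `g` permutes even though it may move `R₊`.
  have h1 := R.sum_roots_eq_two_smul_sum_positive hβ S hS
  have h2 := R.sum_roots_eq_two_smul_sum_positive hβ (fun α => S (g α)) fun α hα => by
    simpa using hS _ ((R.group_action hg).1 α hα)
  have h3 : ∑ α ∈ R.roots, S (g α) = ∑ α ∈ R.roots, S α := by
    refine Finset.sum_bij' (fun α _ => g α) (fun α _ => g⁻¹ α) ?_ ?_ ?_ ?_ ?_
    · exact (R.group_action hg).1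
    · exact (R.group_action (inv_mem hg)).1
    · exact fun α _ => g.symm_apply_apply α
    · exact fun α _ => g.apply_symm_apply α
    · exact fun _ _ => rfl
  rw [h1, h2] at h3
  exact mul_left_cancel₀ two_ne_zero h3

/-- A function on the group which satisfies `z u = ∑ k(α) u(σ_α ·)` with `|z| > ∑ |k(α)|`
vanishes. -/
theorem eq_zero_of_mul_eq_sum [FiniteDimensional ℝ V] {β : V} {k : V → ℂ} {z : ℂ}
    (hz : del (R.positive β) k < ‖z‖) (u : (V ≃ₗᵢ[ℝ] V) → ℂ)
    (hu : ∀ g ∈ R.group, z * u g = ∑ α ∈ R.positive β, k α * u (refl α * g))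
    {g : V ≃ₗᵢ[ℝ] V} (hg : g ∈ R.group) : u g = 0 := by
  -- At a point `m` of maximal modulus, `|z| |u(m)| ≤ δ |u(m)|`, which forces `u(m) = 0`.
  obtain ⟨m, hm⟩ := Finite.exists_max fun g : R.group => ‖u g‖
  have h1 : ‖z‖ * ‖u m‖ ≤ del (R.positive β) k * ‖u m‖ := by
    rw [← norm_mul, hu m m.2, del, Finset.sum_mul]
    refine (norm_sum_le _ _).trans (Finset.sum_le_sum fun α hα => ?_)
    rw [norm_mul]
    exact mul_le_mul_of_nonneg_left
      (hm ⟨_, mul_mem (R.refl_mem_group (R.mem_roots_of_mem_positive hα)) m.2⟩) (norm_nonneg _)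
  have h2 : ‖u m‖ ≤ 0 := by
    by_contra! h
    exact absurd (le_of_mul_le_mul_right h1 h) (not_le.2 hz)
  exact norm_le_zero_iff.1 ((hm ⟨g, hg⟩).trans h2)

end ReducedRootSystem

omit [NormedAddCommGroup V] [InnerProductSpace ℝ V] in
/-- If `δ < |1 + γ|`, then `δ < |n + γ|` for all `n ≥ 1`. -/
theorem del_lt_norm_natCast_add_gam {P : Finset V} {k : V → ℂ}
    (hδ : del P k < ‖1 + gam P k‖) {n : ℕ} (hn : 1 ≤ n) : del P k < ‖(n : ℂ) + gam P k‖ := by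
  refine hδ.trans_le ?_
  have h0 : ‖gam P k‖ < ‖1 + gam P k‖ := (norm_sum_le _ _).trans_lt hδ
  have hn' : (1 : ℝ) ≤ n := by exact_mod_cast hn
  have h1 := pow_lt_pow_left₀ h0 (norm_nonneg _) two_ne_zero
  refine le_of_sq_le_sq ?_ (norm_nonneg _)
  rw [Complex.sq_norm, Complex.sq_norm, Complex.normSq_apply, Complex.normSq_apply] at *
  simp only [Complex.add_re, Complex.add_im, Complex.one_re, Complex.one_im,
    Complex.natCast_re, Complex.natCast_im] at *
  -- `|γ| < |1 + γ|` means `1 + 2 Re γ > 0`, and the difference of squares is `(n - 1)(n + 1 + 2 Re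
  -- γ)`.
  nlinarith

/-! ### The coefficients of the resolvent -/

section Coefficients

variable (P : Finset V) (k : V → ℂ)

theorem cCoeff_zero (g : V ≃ₗᵢ[ℝ] V) [Decidable (g = 1)] :
    cCoeff P k 0 g = if g = 1 then 1 else 0 := by
  simp [cCoeff, eq_comm]

/-- Splits off the first reflection `σ_{α_1}`, which is its own inverse. -/
theorem cCoeff_succ (m : ℕ) (g : V ≃ₗᵢ[ℝ] V) :
    cCoeff P k (m + 1) g = ∑ α ∈ P, k α * cCoeff P k m (refl α * g) := by
  classical
  simp only [cCoeff, Finset.mul_sum]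
  rw [← Finset.sum_product']
  refine Finset.sum_bij' (fun a _ => (a 0, fun i => a i.succ))
    (fun b _ => Fin.cons b.1 b.2) ?_ ?_ ?_ ?_ ?_
  · intro a ha
    simp only [Fintype.mem_piFinset] at ha
    simp [ha]
  · rintro ⟨α, b⟩ hb
    simp only [Finset.mem_product, Fintype.mem_piFinset] at hb
    simp only [Fintype.mem_piFinset]
    intro i
    refine Fin.cases ?_ (fun i => ?_) i <;> simp [hb]
  · intro a _
    exact Fin.cons_self_tail a
  · intro b _
    simp
  · intro a _
    rw [List.ofFn_succ, List.prod_cons, Fin.prod_univ_succ, mul_ite, mul_zero]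
    refine if_congr ?_ rfl rfl
    rw [← refl_inv (a 0), eq_inv_mul_iff_mul_eq, refl_inv]

theorem norm_cCoeff_le (m : ℕ) (g : V ≃ₗᵢ[ℝ] V) : ‖cCoeff P k m g‖ ≤ del P k ^ m := by
  classical
  induction m generalizing g with
  | zero =>
    rw [cCoeff_zero]
    split_ifs <;> simp
  | succ m ih =>
    rw [cCoeff_succ, pow_succ', del, Finset.sum_mul]
    refine (norm_sum_le _ _).trans (Finset.sum_le_sum fun α _ => ?_)
    rw [norm_mul]
    exact mul_le_mul_of_nonneg_left (ih _) (norm_nonneg _)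

omit [NormedAddCommGroup V] [InnerProductSpace ℝ V] in
theorem del_nonneg : 0 ≤ del P k := Finset.sum_nonneg fun _ _ => norm_nonneg _

variable {P k}

theorem summable_norm_cTerm {n : ℕ} (h : del P k < ‖(n : ℂ) + gam P k‖) (g : V ≃ₗᵢ[ℝ] V) :
    Summable fun m => ‖cTerm P k n g m‖ := by
  have hz := (del_nonneg P k).trans_lt h
  refine Summable.of_nonneg_of_le (fun _ => norm_nonneg _) (fun m => ?_)
    ((summable_geometric_of_lt_one (div_nonneg (del_nonneg P k) hz.le)
      ((div_lt_one hz).2 h)).mul_right (‖(n : ℂ) + gam P k‖⁻¹))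
  rw [cTerm, norm_div, norm_pow, div_pow, pow_succ, ← div_eq_mul_inv, div_div]
  gcongr
  exact norm_cCoeff_le P k m g

/-- The resolvent equation read off at the group element `g`: the term `m = 0` gives the identity,
and `cCoeff_succ` shifts the remaining series. -/
theorem mul_bigC {n : ℕ} (h : del P k < ‖(n : ℂ) + gam P k‖) (g : V ≃ₗᵢ[ℝ] V)
    [Decidable (g = 1)] :
    ((n : ℂ) + gam P k) * bigC P k n g =
      (if g = 1 then 1 else 0) + ∑ α ∈ P, k α * bigC P k n (refl α * g) := by
  have hz : (n : ℂ) + gam P k ≠ 0 := norm_pos_iff.1 ((del_nonneg P k).trans_lt h)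
  have hs := fun g => (summable_norm_cTerm h g).of_norm
  have h1 : ∀ m, ((n : ℂ) + gam P k) * cTerm P k n g (m + 1) =
      ∑ α ∈ P, k α * cTerm P k n (refl α * g) m := by
    intro m
    simp only [cTerm, cCoeff_succ, Finset.sum_div, Finset.mul_sum]
    refine Finset.sum_congr rfl fun α _ => ?_
    rw [pow_succ]
    field_simp
  rw [bigC, (hs g).tsum_eq_zero_add, mul_add, ← tsum_mul_left]
  congr 1
  · rw [cTerm, cCoeff_zero, zero_add, pow_one, mul_div_cancel₀ _ hz]
  · simp only [h1, bigC]
    rw [Summable.tsum_finsetSum fun α _ => (hs _).mul_left _]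
    simp only [tsum_mul_left]

end Coefficients

/-- Conjugation by `h` turns `σ_α` into `σ_{hα}`, and both `k(α)` and `σ_α` are unchanged under `α ↦
-α`, so the sum over `R₊` is invariant. -/
theorem cCoeff_conj {R : ReducedRootSystem V} {β : V} (hβ : ∀ α ∈ R.roots, ⟪α, β⟫_ℝ ≠ 0)
    {k : V → ℂ} (hk : IsMultiplicity R k) (m : ℕ) {h : V ≃ₗᵢ[ℝ] V} (hh : h ∈ R.group)
    (g : V ≃ₗᵢ[ℝ] V) :
    cCoeff (R.positive β) k m (h * g * h⁻¹) = cCoeff (R.positive β) k m g := by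
  classical
  induction m generalizing g with
  | zero => simp only [cCoeff_zero, conj_eq_one_iff]
  | succ m ih =>
    rw [cCoeff_succ, cCoeff_succ, ← R.sum_positive_map hβ hh]
    · refine Finset.sum_congr rfl fun α hα => ?_
      rw [hk h hh α (R.mem_roots_of_mem_positive hα), refl_map_eq_conj,
        ← ih (refl α * g)]
      congr 2
      group
    · intro α hα
      rw [refl_neg, ← refl_self, hk _ (R.refl_mem_group hα) α hα]

theorem bigC_conj {R : ReducedRootSystem V} {β : V} (hβ : ∀ α ∈ R.roots, ⟪α, β⟫_ℝ ≠ 0)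
    {k : V → ℂ} (hk : IsMultiplicity R k) (n : ℕ) {h : V ≃ₗᵢ[ℝ] V} (hh : h ∈ R.group)
    (g : V ≃ₗᵢ[ℝ] V) :
    bigC (R.positive β) k n (h * g * h⁻¹) = bigC (R.positive β) k n g := by
  simp only [bigC, cTerm, cCoeff_conj hβ hk _ hh]

/-! ### The resolvent -/

section Resolvent

theorem act_apply (n : ℕ) (g : V ≃ₗᵢ[ℝ] V) (f : homog V n) (x : V) :
    (act n g f : V → ℂ) x = (f : V → ℂ) (g x) := rfl

theorem shiftedA_apply (P : Finset V) (k : V → ℂ) (n : ℕ) (f : homog V n) (x : V) :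
    (shiftedA P k n f : V → ℂ) x =
      ((n : ℂ) + gam P k) * (f : V → ℂ) x - ∑ α ∈ P, k α * (f : V → ℂ) (refl α x) := by
  simp [shiftedA, opA, act_apply]

theorem sum_smul_act_apply {ι : Type*} (s : Finset ι) (c : ι → ℂ) (g : ι → V ≃ₗᵢ[ℝ] V) (n : ℕ)
    (f : homog V n) (x : V) :
    ((∑ i ∈ s, c i • act n (g i)) f : V → ℂ) x = ∑ i ∈ s, c i * (f : V → ℂ) (g i x) := by
  simp [act_apply]

variable [FiniteDimensional ℝ V] {R : ReducedRootSystem V} {β : V}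
    (hβ : ∀ α ∈ R.roots, ⟪α, β⟫_ℝ ≠ 0) {k : V → ℂ} (hk : IsMultiplicity R k) {n : ℕ}
    (hn : del (R.positive β) k < ‖(n : ℂ) + gam (R.positive β) k‖)

include hn in
theorem sum_mul_bigC_sub_mul (f : V → ℂ) (x : V) :
    ∑ g : R.group, (((n : ℂ) + gam (R.positive β) k) * bigC (R.positive β) k n g -
      ∑ α ∈ R.positive β, k α * bigC (R.positive β) k n (refl α * g)) *
        f ((g : V ≃ₗᵢ[ℝ] V) x) = f x := by
  classical
  simp only [mul_bigC hn, add_sub_cancel_right, ite_mul, one_mul, zero_mul]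
  rw [Finset.sum_eq_single 1]
  · simp
  · intro g _ hg
    simp [hg]
  · simp

include hn in
-- `act` reverses products, so here `σ_α` multiplies `g` on the left, as in `mul_bigC`, and
-- invariance of `k` plays no role.
theorem sum_bigC_smul_act_mul_shiftedA :
    (∑ g : R.group, bigC (R.positive β) k n g • act n (g : V ≃ₗᵢ[ℝ] V)) *
      shiftedA (R.positive β) k n = 1 := by
  refine LinearMap.ext fun f => Subtype.ext (funext fun x => ?_)
  rw [Module.End.mul_apply, Module.End.one_apply, sum_smul_act_apply,
    ← sum_mul_bigC_sub_mul hn (f : V → ℂ) x]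
  simp only [shiftedA_apply, mul_sub, sub_mul, Finset.sum_sub_distrib, Finset.mul_sum,
    Finset.sum_mul]
  congr 1
  · exact Finset.sum_congr rfl fun g _ => by ring
  rw [Finset.sum_comm]
  conv_rhs => rw [Finset.sum_comm]
  refine Finset.sum_congr rfl fun α hα => ?_
  let s : R.group := ⟨refl α, R.refl_mem_group (R.mem_roots_of_mem_positive hα)⟩
  refine Fintype.sum_equiv (Equiv.mulLeft s) _ _ fun g => ?_
  change _ = k α * bigC (R.positive β) k n (refl α * (refl α * g)) *
    (f : V → ℂ) (refl α ((g : V ≃ₗᵢ[ℝ] V) x))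
  rw [← mul_assoc (refl α), refl_mul_self, one_mul]
  ring

include hβ hk hn in
-- In this order `σ_α` multiplies `g` on the right; `bigC_conj` moves it to the left.
theorem shiftedA_mul_sum_bigC_smul_act :
    shiftedA (R.positive β) k n *
      (∑ g : R.group, bigC (R.positive β) k n g • act n (g : V ≃ₗᵢ[ℝ] V)) = 1 := by
  refine LinearMap.ext fun f => Subtype.ext (funext fun x => ?_)
  rw [Module.End.mul_apply, Module.End.one_apply, shiftedA_apply,
    ← sum_mul_bigC_sub_mul hn (f : V → ℂ) x]
  simp only [sum_smul_act_apply, sub_mul, Finset.sum_sub_distrib, Finset.mul_sum,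
    Finset.sum_mul]
  congr 1
  · exact Finset.sum_congr rfl fun g _ => by ring
  conv_rhs => rw [Finset.sum_comm]
  refine Finset.sum_congr rfl fun α hα => ?_
  let s : R.group := ⟨refl α, R.refl_mem_group (R.mem_roots_of_mem_positive hα)⟩
  refine Fintype.sum_equiv (Equiv.mulRight s) _ _ fun g => ?_
  change _ = k α * bigC (R.positive β) k n (refl α * (g * refl α)) *
    (f : V → ℂ) ((g : V ≃ₗᵢ[ℝ] V) (refl α x))
  rw [← bigC_conj hβ hk n s.2 g, refl_inv, mul_assoc (refl α), mul_assoc]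

include hβ hk hn

theorem isUnit_shiftedA : IsUnit (shiftedA (R.positive β) k n) :=
  ⟨⟨_, _, shiftedA_mul_sum_bigC_smul_act hβ hk hn, sum_bigC_smul_act_mul_shiftedA hn⟩, rfl⟩

theorem resolventH_eq_sum :
    resolventH (R.positive β) k n =
      ∑ g : R.group, bigC (R.positive β) k n g • act n (g : V ≃ₗᵢ[ℝ] V) :=
  Ring.inverse_unit ⟨_, _, shiftedA_mul_sum_bigC_smul_act hβ hk hn,
    sum_bigC_smul_act_mul_shiftedA hn⟩

end Resolvent

section Polynomials

/-! ### Homogeneous polynomials and directional derivatives -/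

theorem contDiff_of_mem_homog {n : ℕ} {f : V → ℂ} (hf : f ∈ homog V n) : ContDiff ℝ 2 f := by
  obtain ⟨M, hM⟩ := hf
  obtain rfl : f = fun x => M fun _ => x := funext hM
  exact M.contDiff.comp (contDiff_pi.2 fun _ => contDiff_id)

theorem eq_of_mem_homog_zero {f : V → ℂ} (hf : f ∈ homog V 0) (x y : V) : f x = f y := by
  obtain ⟨M, hM⟩ := hf
  rw [hM, hM]
  congr 1
  exact Subsingleton.elim _ _

theorem apply_smul_of_mem_homog {n : ℕ} {f : V → ℂ} (hf : f ∈ homog V n) (t : ℝ) (x : V) :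
    f (t • x) = (t : ℂ) ^ n * f x := by
  obtain ⟨M, hM⟩ := hf
  rw [hM, hM]
  have := M.map_smul_univ (fun _ => t) (fun _ => x)
  simpa using this

/-- Euler's identity. -/
theorem dirDeriv_self_of_mem_homog {n : ℕ} {f : V → ℂ} (hf : f ∈ homog V n) (x : V) :
    dirDeriv x f x = n * f x := by
  obtain ⟨M, hM⟩ := hf
  obtain rfl : f = fun x => M fun _ => x := funext hM
  have h : HasFDerivAt (fun x : V => M fun _ => x)
      ((M.linearDeriv fun _ => x).comp
        (ContinuousLinearMap.pi fun _ => ContinuousLinearMap.id ℝ V)) x :=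
    (M.hasFDerivAt (fun _ => x)).comp x (hasFDerivAt_pi.2 fun _ => hasFDerivAt_id x)
  rw [dirDeriv, h.fderiv]
  simp [ContinuousMultilinearMap.linearDeriv_apply]

theorem dirDeriv_smul (ξ : V) (c : ℂ) (f : V → ℂ) : dirDeriv ξ (c • f) = c • dirDeriv ξ f := by
  ext x
  simp [dirDeriv, fderiv_const_smul_field]

theorem dirDeriv_comp (g : V ≃ₗᵢ[ℝ] V) (ξ : V) (f : V → ℂ) (x : V) :
    dirDeriv ξ (fun y => f (g y)) x = dirDeriv (g ξ) f (g x) := by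
  have := g.toContinuousLinearEquiv.comp_right_fderiv (f := f) (x := x)
  exact DFunLike.congr_fun this ξ

theorem dirDeriv_comm {f : V → ℂ} (hf : ContDiff ℝ 2 f) (ξ η : V) :
    dirDeriv ξ (dirDeriv η f) = dirDeriv η (dirDeriv ξ f) := by
  have h : ∀ ξ η x, dirDeriv ξ (dirDeriv η f) x = fderiv ℝ (fderiv ℝ f) x ξ η := by
    intro ξ η x
    have hd : DifferentiableAt ℝ (fderiv ℝ f) x :=
      (hf.fderiv_right (m := 1) (by norm_num)).differentiable (by norm_num) x
    have := (hd.hasFDerivAt.clm_apply (hasFDerivAt_const η x)).fderiv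
    change fderiv ℝ (fun y => fderiv ℝ f y η) x ξ = _
    rw [this]
    simp
  ext x
  rw [h, h]
  exact (hf.contDiffAt.isSymmSndFDerivAt (by simp)) ξ η

/-- The directional derivative as a linear map `𝒫_{n+1} → 𝒫_n`. -/
def homogDeriv (n : ℕ) (ξ : V) : homog V (n + 1) →ₗ[ℂ] homog V n where
  toFun f := ⟨dirDeriv ξ f, dirDeriv_mem_homog f.2 ξ⟩
  map_add' f g := Subtype.ext (dirDeriv_add ξ (differentiable_of_mem_homog f.2)
    (differentiable_of_mem_homog g.2))
  map_smul' c f := Subtype.ext (dirDeriv_smul ξ c f)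

theorem homogDeriv_add (n : ℕ) (ξ η : V) (f : homog V (n + 1)) :
    homogDeriv n (ξ + η) f = homogDeriv n ξ f + homogDeriv n η f :=
  Subtype.ext (funext fun x => (fderiv ℝ (f : V → ℂ) x).map_add ξ η)

theorem homogDeriv_smul (n : ℕ) (c : ℝ) (ξ : V) (f : homog V (n + 1)) :
    homogDeriv n (c • ξ) f = (c : ℂ) • homogDeriv n ξ f :=
  Subtype.ext (funext fun x => (fderiv ℝ (f : V → ℂ) x).map_smul c ξ)

theorem clm_mul_mem_homog {n : ℕ} {f : V → ℂ} (hf : f ∈ homog V n) (l : V →L[ℝ] ℝ) :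
    (fun x => (l x : ℂ) * f x) ∈ homog V (n + 1) := by
  obtain ⟨M, hM⟩ := hf
  refine ⟨(l.smulRight M).uncurryLeft, fun x => ?_⟩
  simp only [ContinuousLinearMap.uncurryLeft_apply, ContinuousLinearMap.smulRight_apply,
    smul_apply, Complex.real_smul, hM]
  rfl

/-! ### Contractions `x ↦ q_x(x)` of linear families -/

section Diagonal

variable [FiniteDimensional ℝ V] (q : V →ₗ[ℝ] V → ℂ)

theorem diagonal_eq_sum (x : V) :
    q x = ∑ i, ((⟪stdOrthonormalBasis ℝ V i, x⟫_ℝ : ℝ) : ℂ) • q (stdOrthonormalBasis ℝ V i) := by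
  conv_lhs => rw [← (stdOrthonormalBasis ℝ V).sum_repr' x, map_sum]
  refine Finset.sum_congr rfl fun i _ => ?_
  rw [map_smul]
  ext y
  simp

theorem diagonal_mem_homog {n : ℕ} (hq : ∀ ξ, q ξ ∈ homog V n) :
    (fun x => q x x) ∈ homog V (n + 1) := by
  have : (fun x => q x x) = ∑ i, fun x =>
      ((innerSL ℝ (stdOrthonormalBasis ℝ V i) x : ℝ) : ℂ) * q (stdOrthonormalBasis ℝ V i) x := by
    ext x
    rw [diagonal_eq_sum]
    simp
  rw [this]
  exact sum_mem fun i _ => clm_mul_mem_homog (hq _) _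

/-- The product rule for `∑ ⟨e_i, x⟩ q_{e_i}(x)`; in the last term the index `x` is frozen. -/
theorem dirDeriv_diagonal (hq : ∀ ξ, Differentiable ℝ (q ξ)) (ξ x : V) :
    dirDeriv ξ (fun y => q y y) x = q ξ x + dirDeriv ξ (q x) x := by
  set b := stdOrthonormalBasis ℝ V
  have h1 : (fun y => q y y) = fun y => ∑ i, ((innerSL ℝ (b i) y : ℝ) : ℂ) * q (b i) y := by
    ext x
    rw [diagonal_eq_sum]
    simp [b]
  have h2 : ∀ i, HasFDerivAt (fun y => ((innerSL ℝ (b i) y : ℝ) : ℂ))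
      (Complex.ofRealCLM.comp (innerSL ℝ (b i))) x := fun i =>
    (Complex.ofRealCLM.comp (innerSL ℝ (b i))).hasFDerivAt
  have h3 := HasFDerivAt.fun_sum (u := Finset.univ)
    fun i _ => (h2 i).fun_mul ((hq (b i)) x).hasFDerivAt
  have h4 : dirDeriv ξ (q x) x = ∑ i, ((⟪b i, x⟫_ℝ : ℝ) : ℂ) * dirDeriv ξ (q (b i)) x := by
    have h5 : q x = fun y => ∑ i, ((⟪b i, x⟫_ℝ : ℝ) : ℂ) * q (b i) y := by
      ext y
      rw [diagonal_eq_sum]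
      simp [b]
    rw [h5]
    have := HasFDerivAt.fun_sum (u := Finset.univ)
      fun i _ => ((hq (b i)) x).hasFDerivAt.const_mul ((⟪b i, x⟫_ℝ : ℝ) : ℂ)
    rw [dirDeriv, this.fderiv]
    simp [dirDeriv]
  rw [h4, dirDeriv, h1, h3.fderiv, diagonal_eq_sum q ξ]
  simp only [sum_apply, add_apply,
    smul_apply, ContinuousLinearMap.comp_apply, Finset.sum_add_distrib,
    innerSL_apply_apply, Finset.sum_apply, Pi.smul_apply, smul_eq_mul, Complex.ofRealCLM_apply]
  rw [add_comm]
  congr 1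
  exact Finset.sum_congr rfl fun i _ => mul_comm _ _

end Diagonal

/-! ### Dunkl operators -/

theorem ofReal_inner_mul_dividedDiff (α : V) (f : V → ℂ) (x : V) :
    ((⟪α, x⟫_ℝ : ℝ) : ℂ) * dividedDiff α f x = f x - f (refl α x) := by
  rw [dividedDiff]
  split_ifs with h
  · simp [h, refl_eq_self h]
  · rw [mul_div_cancel₀]
    exact_mod_cast h

theorem dividedDiff_add (α : V) {f g : V → ℂ} (hf : Differentiable ℝ f)
    (hg : Differentiable ℝ g) : dividedDiff α (f + g) = dividedDiff α f + dividedDiff α g := by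
  ext x
  simp only [dividedDiff, dirDeriv_add α hf hg, Pi.add_apply]
  split_ifs <;> ring

theorem dividedDiff_smul (α : V) (c : ℂ) (f : V → ℂ) :
    dividedDiff α (c • f) = c • dividedDiff α f := by
  ext x
  simp only [dividedDiff, dirDeriv_smul, Pi.smul_apply, smul_eq_mul]
  split_ifs <;> ring

theorem dividedDiff_map (g : V ≃ₗᵢ[ℝ] V) (α : V) (f : V → ℂ) (x : V) :
    dividedDiff (g α) f (g x) = dividedDiff α (fun y => f (g y)) x := by
  simp only [dividedDiff, dirDeriv_comp, refl_map, g.inner_map_map]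

theorem dirDeriv_neg_dir (ξ : V) (f : V → ℂ) (x : V) : dirDeriv (-ξ) f x = -dirDeriv ξ f x :=
  (fderiv ℝ f x).map_neg ξ

theorem dividedDiff_neg (α : V) (f : V → ℂ) (x : V) :
    dividedDiff (-α) f x = -dividedDiff α f x := by
  simp only [dividedDiff, dirDeriv_neg_dir, refl_neg, inner_neg_left, inner_neg_right, neg_neg,
    neg_eq_zero, Complex.ofReal_neg, div_neg, mul_neg]
  split_ifs <;> rfl

variable (P : Finset V) (k : V → ℂ)

theorem dunklOp_add (ξ : V) {f g : V → ℂ} (hf : Differentiable ℝ f) (hg : Differentiable ℝ g) :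
    dunklOp P k ξ (f + g) = dunklOp P k ξ f + dunklOp P k ξ g := by
  ext x
  simp only [dunklOp, dirDeriv_add ξ hf hg, dividedDiff_add _ hf hg, Pi.add_apply, mul_add,
    Finset.sum_add_distrib]
  ring

theorem dunklOp_smul (ξ : V) (c : ℂ) (f : V → ℂ) :
    dunklOp P k ξ (c • f) = c • dunklOp P k ξ f := by
  ext x
  simp only [dunklOp, dirDeriv_smul, dividedDiff_smul, Pi.smul_apply, smul_eq_mul, mul_add,
    Finset.mul_sum]
  congr 1
  exact Finset.sum_congr rfl fun α _ => by ring

theorem dunklOp_zero (ξ : V) : dunklOp P k ξ 0 = 0 := by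
  simpa using dunklOp_smul P k ξ 0 0

theorem dunklOp_sum {ι : Type*} (s : Finset ι) (ξ : V) (c : ι → ℂ) (f : ι → V → ℂ)
    (hf : ∀ i ∈ s, Differentiable ℝ (f i)) :
    dunklOp P k ξ (∑ i ∈ s, c i • f i) = ∑ i ∈ s, c i • dunklOp P k ξ (f i) := by
  classical
  have hd : ∀ t ⊆ s, Differentiable ℝ (∑ i ∈ t, c i • f i) := fun t ht =>
    Differentiable.sum fun i hi => (hf i (ht hi)).const_smul (c i)
  induction s using Finset.induction_on with
  | empty => simp [dunklOp_zero]
  | insert a s ha ih =>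
    rw [Finset.sum_insert ha, Finset.sum_insert ha, dunklOp_add P k ξ, dunklOp_smul, ih]
    · exact fun i hi => hf i (Finset.mem_insert_of_mem hi)
    · exact fun t ht => hd t (ht.trans (Finset.subset_insert _ _))
    · exact (hf a (Finset.mem_insert_self _ _)).const_smul (c a)
    · exact hd s (Finset.subset_insert _ _)

/-- The Euler operator of Dunkl operators acts on `𝒫_n` as `(n + γ) - A_n`. -/
theorem dunklOp_self_of_mem_homog {n : ℕ} {f : V → ℂ} (hf : f ∈ homog V n) (x : V) :
    dunklOp P k x f x = ((n : ℂ) + gam P k) * f x - ∑ α ∈ P, k α * f (refl α x) := by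
  simp only [dunklOp, mul_assoc, ofReal_inner_mul_dividedDiff, dirDeriv_self_of_mem_homog hf,
    mul_sub, Finset.sum_sub_distrib, ← Finset.sum_mul, gam]
  ring

theorem dunklOp_of_mem_homog_zero {f : V → ℂ} (hf : f ∈ homog V 0) (ξ : V) :
    dunklOp P k ξ f = 0 := by
  obtain ⟨c, rfl⟩ : ∃ c : ℂ, f = fun _ => c :=
    ⟨f 0, funext fun x => eq_of_mem_homog_zero hf x 0⟩
  ext x
  simp [dunklOp, dividedDiff, dirDeriv]

/-- Off the hyperplane, expand the index `σ_α x` of `q` by linearity; on it, this is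
`dirDeriv_diagonal` in the direction `α`. -/
theorem dividedDiff_diagonal [FiniteDimensional ℝ V] (q : V →ₗ[ℝ] V → ℂ)
    (hq : ∀ ξ, Differentiable ℝ (q ξ)) (α x : V) :
    dividedDiff α (fun y => q y y) x =
      dividedDiff α (q x) x + (2 / ⟪α, α⟫_ℝ : ℝ) * q α (refl α x) := by
  simp only [dividedDiff]
  split_ifs with h
  · rw [dirDeriv_diagonal q hq, refl_eq_self h]
    ring
  · have h' : ((⟪α, x⟫_ℝ : ℝ) : ℂ) ≠ 0 := by exact_mod_cast h
    have h1 : q (refl α x) (refl α x) =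
        q x (refl α x) - ((2 * (⟪α, x⟫_ℝ / ⟪α, α⟫_ℝ) : ℝ) : ℂ) * q α (refl α x) := by
      conv_lhs => rw [refl_apply α x, map_sub, map_smul, ← refl_apply]
      simp
    rw [h1]
    push_cast
    field_simp
    ring

/-- The commutation relation of Dunkl operators and multiplications, contracted with `q`. -/
theorem dunklOp_diagonal [FiniteDimensional ℝ V] (q : V →ₗ[ℝ] V → ℂ) {n : ℕ}
    (hq : ∀ ξ, q ξ ∈ homog V n)
    (hsymm : ∀ ξ η, dunklOp P k ξ (q η) = dunklOp P k η (q ξ)) (ξ x : V) :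
    dunklOp P k ξ (fun y => q y y) x =
      ((n : ℂ) + 1 + gam P k) * q ξ x -
        ∑ α ∈ P, k α * q (refl α ξ) (refl α x) := by
  have hd := fun ξ => differentiable_of_mem_homog (hq ξ)
  have h1 : dunklOp P k ξ (fun y => q y y) x = dunklOp P k ξ (q x) x + q ξ x +
      -- The correction terms are rewritten through `ξ - σ_α ξ = (2⟨α, ξ⟩ / ⟨α, α⟩) α`.
      ∑ α ∈ P, k α * (q ξ (refl α x) - q (refl α ξ) (refl α x)) := by
    simp only [dunklOp, dirDeriv_diagonal q hd, dividedDiff_diagonal q hd, mul_add,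
      Finset.sum_add_distrib]
    have : ∀ α ∈ P, k α * (q ξ (refl α x) - q (refl α ξ) (refl α x)) =
        k α * ((⟪α, ξ⟫_ℝ : ℝ) : ℂ) * (((2 / ⟪α, α⟫_ℝ : ℝ) : ℂ) * q α (refl α x)) := by
      intro α _
      rw [refl_apply α ξ, map_sub, map_smul]
      simp only [Pi.sub_apply, Pi.smul_apply, Complex.real_smul]
      push_cast
      ring
    rw [Finset.sum_congr rfl this]
    ring
  -- Symmetry turns `T_ξ q_x` at `x` into `T_x q_ξ` at `x`, where Euler's identity applies; the
  -- terms `q_ξ(σ_α x)` then cancel.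
  rw [h1, hsymm, dunklOp_self_of_mem_homog P k (hq ξ)]
  simp only [mul_sub, Finset.sum_sub_distrib]
  ring

variable {P k}

/-- The summands are even in `α`, the inner product and the divided difference both changing sign,
so `sum_positive_map` applies. -/
theorem dunklOp_comp {R : ReducedRootSystem V} {β : V} (hβ : ∀ α ∈ R.roots, ⟪α, β⟫_ℝ ≠ 0)
    (hk : IsMultiplicity R k) {g : V ≃ₗᵢ[ℝ] V} (hg : g ∈ R.group) (ξ : V) (f : V → ℂ) (x : V) :
    dunklOp (R.positive β) k ξ (fun y => f (g y)) x =
      dunklOp (R.positive β) k (g ξ) f (g x) := by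
  rw [dunklOp, dunklOp, dirDeriv_comp]
  congr 1
  rw [← R.sum_positive_map hβ hg
    fun α => k α * ((⟪α, g ξ⟫_ℝ : ℝ) : ℂ) * dividedDiff α f (g x)]
  · refine Finset.sum_congr rfl fun α hα => ?_
    rw [hk g hg α (R.mem_roots_of_mem_positive hα), g.inner_map_map, dividedDiff_map]
  · intro α hα
    have : k (-α) = k α := by rw [← refl_self, hk _ (R.refl_mem_group hα) α hα]
    rw [this, dividedDiff_neg, inner_neg_left]
    push_cast
    ring

end Polynomials

/-! ### The intertwining operator on `𝒫_n` -/

section Raise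

variable {n : ℕ} (L : homog V n →ₗ[ℂ] homog V n)

/-- The linear family `ξ ↦ L (∂_ξ p)`. -/
def derivFamily (p : homog V (n + 1)) : V →ₗ[ℝ] V → ℂ where
  toFun ξ := L (homogDeriv n ξ p)
  map_add' ξ η := by rw [homogDeriv_add, map_add]; rfl
  map_smul' c ξ := by
    rw [homogDeriv_smul, map_smul]
    ext x
    simp

theorem derivFamily_apply (p : homog V (n + 1)) (ξ : V) :
    derivFamily L p ξ = L (homogDeriv n ξ p) := rfl

/-- The endomorphism `p ↦ (x ↦ L (∂_x p) (x))` of `𝒫_{n+1}` obtained from an endomorphism `L`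
of `𝒫_n`. -/
def raise [FiniteDimensional ℝ V] : homog V (n + 1) →ₗ[ℂ] homog V (n + 1) where
  toFun p := ⟨fun x => derivFamily L p x x, diagonal_mem_homog _ fun _ => Subtype.property _⟩
  map_add' p q := Subtype.ext (funext fun x => by
    simp only [derivFamily_apply, map_add, Submodule.coe_add, Pi.add_apply])
  map_smul' c p := Subtype.ext (funext fun x => by
    simp only [derivFamily_apply, map_smul, Submodule.coe_smul, Pi.smul_apply, RingHom.id_apply])

theorem raise_coe [FiniteDimensional ℝ V] (p : homog V (n + 1)) :
    (raise L p : V → ℂ) = fun x => derivFamily L p x x := rfl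

end Raise

variable [FiniteDimensional ℝ V]

/-- The restriction of the intertwining operator to `𝒫_n`, defined recursively through the
resolvents. -/
def homogIntertwiner (P : Finset V) (k : V → ℂ) : ∀ n, homog V n →ₗ[ℂ] homog V n
  | 0 => LinearMap.id
  | n + 1 => resolventH P k (n + 1) ∘ₗ raise (homogIntertwiner P k n)

section

variable {R : ReducedRootSystem V} {β : V} (hβ : ∀ α ∈ R.roots, ⟪α, β⟫_ℝ ≠ 0) {k : V → ℂ}
  (hk : IsMultiplicity R k) (hδ : del (R.positive β) k < ‖1 + gam (R.positive β) k‖)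

include hβ hk hδ

theorem shiftedA_homogIntertwiner {n : ℕ} (p : homog V (n + 1)) :
    shiftedA (R.positive β) k (n + 1) (homogIntertwiner (R.positive β) k (n + 1) p) =
      raise (homogIntertwiner (R.positive β) k n) p := by
  have h := Ring.mul_inverse_cancel _ (isUnit_shiftedA (n := n + 1) hβ hk
    (del_lt_norm_natCast_add_gam hδ (Nat.le_add_left 1 n)))
  exact LinearMap.congr_fun h (raise (homogIntertwiner (R.positive β) k n) p)

/-- The inductive step of existence: symmetry of `T_ξ q_η` one degree lower yields the intertwining
relation. -/
theorem dunklOp_homogIntertwiner_of_symm {n : ℕ} (p : homog V (n + 1))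
    (hsymm : ∀ ξ η, dunklOp (R.positive β) k ξ
        (derivFamily (homogIntertwiner (R.positive β) k n) p η) =
      dunklOp (R.positive β) k η (derivFamily (homogIntertwiner (R.positive β) k n) p ξ))
    (ξ : V) :
    dunklOp (R.positive β) k ξ (homogIntertwiner (R.positive β) k (n + 1) p) =
      derivFamily (homogIntertwiner (R.positive β) k n) p ξ := by
  set q := derivFamily (homogIntertwiner (R.positive β) k n) p with hq
  set f := homogIntertwiner (R.positive β) k (n + 1) p with hf
  set z : ℂ := ((n + 1 : ℕ) : ℂ) + gam (R.positive β) k with hz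
  have hfd := differentiable_of_mem_homog f.2
  have hfdα : ∀ α ∈ R.positive β, Differentiable ℝ fun y => (f : V → ℂ) (refl α y) :=
    fun α _ => hfd.comp (refl α).differentiable
  have hF : (fun y => q y y) =
      z • (f : V → ℂ) + ∑ α ∈ R.positive β, (-k α) • fun y => (f : V → ℂ) (refl α y) := by
    rw [hq, ← raise_coe, ← shiftedA_homogIntertwiner hβ hk hδ]
    ext x
    rw [shiftedA_apply]
    simp [sub_eq_add_neg, f, z]
  have key : ∀ ξ x, z * (dunklOp (R.positive β) k ξ f x - q ξ x) =
      ∑ α ∈ R.positive β, k α *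
        (dunklOp (R.positive β) k (refl α ξ) f (refl α x) - q (refl α ξ) (refl α x)) := by
    intro ξ x
    have h1 := dunklOp_diagonal (R.positive β) k q (n := n) (fun ξ => Subtype.property _) hsymm ξ x
    rw [hF, dunklOp_add _ _ _ (hfd.const_smul z)
        (Differentiable.sum fun α hα => (hfdα α hα).const_smul _), dunklOp_smul,
      dunklOp_sum _ _ _ _ _ _ hfdα] at h1
    have h2 : ∀ α ∈ R.positive β, ((-k α) • dunklOp (R.positive β) k ξ
        fun y => (f : V → ℂ) (refl α y)) x =
        -(k α * dunklOp (R.positive β) k (refl α ξ) f (refl α x)) := by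
      intro α hα
      rw [Pi.smul_apply,
        dunklOp_comp hβ hk (R.refl_mem_group (R.mem_roots_of_mem_positive hα)), smul_eq_mul,
        neg_mul]
    rw [Pi.add_apply, Finset.sum_apply, Finset.sum_congr rfl h2] at h1
    simp only [Pi.smul_apply, smul_eq_mul, Finset.sum_neg_distrib] at h1
    simp only [mul_sub, Finset.sum_sub_distrib]
    have hz' : z = (n : ℂ) + 1 + gam (R.positive β) k := by rw [hz]; push_cast; ring
    rw [← hz'] at h1
    linear_combination h1
  ext x
  -- The maximum argument runs along the simultaneous orbit `g ↦ D_{gξ}(gx)`.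
  have h0 := R.eq_zero_of_mul_eq_sum
    (del_lt_norm_natCast_add_gam hδ (Nat.le_add_left 1 n))
    (fun g => dunklOp (R.positive β) k (g ξ) f (g x) - q (g ξ) (g x))
    (fun g _ => key (g ξ) (g x)) (one_mem _)
  exact sub_eq_zero.1 h0

theorem dunklOp_homogIntertwiner {n : ℕ} (p : homog V (n + 1)) (ξ : V) :
    dunklOp (R.positive β) k ξ (homogIntertwiner (R.positive β) k (n + 1) p) =
      homogIntertwiner (R.positive β) k n (homogDeriv n ξ p) := by
  refine dunklOp_homogIntertwiner_of_symm hβ hk hδ p (fun ξ η => ?_) ξ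
  simp only [derivFamily_apply]
  induction n generalizing ξ η with
  | zero => rw [dunklOp_of_mem_homog_zero _ _ (Subtype.property _),
      dunklOp_of_mem_homog_zero _ _ (Subtype.property _)]
  | succ n ih =>
    rw [dunklOp_homogIntertwiner_of_symm hβ hk hδ _ (ih _),
      dunklOp_homogIntertwiner_of_symm hβ hk hδ _ (ih _), derivFamily_apply, derivFamily_apply]
    congr 2
    exact Subtype.ext (dirDeriv_comm (contDiff_of_mem_homog p.2) ξ η)

/-- If `p` is killed, so is every `∂_ξ p` by the intertwining relation; by induction all `∂_ξ p`
vanish, and Euler's identity gives `p = 0`. -/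
theorem homogIntertwiner_injective (n : ℕ) :
    Function.Injective (homogIntertwiner (R.positive β) k n) := by
  induction n with
  | zero => exact Function.injective_id
  | succ n ih =>
    refine (injective_iff_map_eq_zero _).2 fun p hp => ?_
    have h : ∀ ξ, homogDeriv n ξ p = 0 := fun ξ => by
      refine (injective_iff_map_eq_zero _).1 ih _ (Subtype.ext ?_)
      rw [← dunklOp_homogIntertwiner hβ hk hδ, hp]
      exact dunklOp_zero _ _ _
    refine Subtype.ext (funext fun x => ?_)
    have h1 := dirDeriv_self_of_mem_homog p.2 x
    have h2 : dirDeriv x p x = 0 := congrFun (congrArg Subtype.val (h x)) x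
    rw [h2] at h1
    exact (mul_eq_zero.1 h1.symm).resolve_left (Nat.cast_ne_zero.2 n.succ_ne_zero)

end

/-- Finite dimension makes the injective endomorphisms `homogIntertwiner` bijective. -/
instance finite_homog (n : ℕ) : Module.Finite ℂ (homog V n) := by
  let e : ContinuousMultilinearMap ℝ (fun _ : Fin n => V) ℂ →ₗ[ℝ] homog V n :=
    { toFun := fun M => ⟨fun x => M fun _ => x, M, fun _ => rfl⟩
      map_add' := fun _ _ => rfl
      map_smul' := fun _ _ => Subtype.ext (funext fun _ => by simp) }
  have : Module.Finite ℝ (ContinuousMultilinearMap ℝ (fun _ : Fin n => V) ℂ) :=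
    Module.Finite.of_injective
      (ContinuousMultilinearMap.toMultilinearMapLinear (R' := ℝ) (A := ℝ))
      ContinuousMultilinearMap.toMultilinearMap_injective
  have : Module.Finite ℝ (homog V n) := Module.Finite.of_surjective e fun f => by
    obtain ⟨M, hM⟩ := f.2
    exact ⟨M, Subtype.ext (funext fun x => (hM x).symm)⟩
  exact Module.Finite.of_restrictScalars_finite ℝ ℂ _

/-! ### The grading of the space of polynomials -/

variable (V) in
omit [FiniteDimensional ℝ V] in
-- The `𝒫_n` lie in eigenspaces of `f ↦ f(2 ·)` for the distinct eigenvalues `2^n`.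
theorem iSupIndep_homog : iSupIndep (homog V) := by
  let T : Module.End ℂ (V → ℂ) := LinearMap.funLeft ℂ ℂ fun x : V => (2 : ℝ) • x
  have h1 : Function.Injective fun n : ℕ => (2 : ℂ) ^ n := fun m n h => by
    have : ((2 ^ m : ℕ) : ℂ) = (2 ^ n : ℕ) := by simpa using h
    exact Nat.pow_right_injective le_rfl (Nat.cast_injective this)
  refine (T.eigenspaces_iSupIndep.comp h1).mono fun n f hf => ?_
  refine Module.End.mem_eigenspace_iff.2 (funext fun x => ?_)
  change f ((2 : ℝ) • x) = _
  simpa using apply_smul_of_mem_homog hf 2 x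

variable (V) in
/-- The decomposition of the space of polynomials into homogeneous components. -/
def polyEquiv : (Π₀ n, homog V n) ≃ₗ[ℂ] poly V :=
  (LinearEquiv.ofInjective _ (iSupIndep_homog V).dfinsupp_lsum_injective).trans
    (LinearEquiv.ofEq _ _ (Submodule.iSup_eq_range_dfinsupp_lsum (homog V)).symm)

omit [FiniteDimensional ℝ V] in
theorem polyEquiv_single {n : ℕ} (p : homog V n) :
    polyEquiv V (DFinsupp.single n p) = ⟨p, homog_le_poly n p.2⟩ :=
  Subtype.ext (DFinsupp.lsum_single (S := ℕ) (fun n => (homog V n).subtype) n p)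

omit [FiniteDimensional ℝ V] in
theorem poly_induction {C : poly V → Prop}
    (homogeneous : ∀ n (p : V → ℂ) (hp : p ∈ homog V n), C ⟨p, homog_le_poly n hp⟩)
    (add : ∀ p q, C p → C q → C (p + q)) (p : poly V) : C p := by
  obtain ⟨p, hp⟩ := p
  induction hp using Submodule.iSup_induction' with
  | mem n p hp => exact homogeneous n p hp
  | zero => exact homogeneous 0 0 (zero_mem _)
  | add p q hp hq h1 h2 => exact add _ _ h1 h2

omit [FiniteDimensional ℝ V] in
theorem polyDeriv_add (ξ : V) (p q : poly V) :
    polyDeriv ξ (p + q) = polyDeriv ξ p + polyDeriv ξ q :=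
  Subtype.ext (dirDeriv_add ξ (differentiable_of_mem_poly p.2) (differentiable_of_mem_poly q.2))

/-! ### Existence of the intertwining operator -/

section Existence

variable {R : ReducedRootSystem V} {β : V} (hβ : ∀ α ∈ R.roots, ⟪α, β⟫_ℝ ≠ 0) {k : V → ℂ}
  (hk : IsMultiplicity R k) (hδ : del (R.positive β) k < ‖1 + gam (R.positive β) k‖)

/-- The intertwining operator, assembled from its restrictions to the `𝒫_n`. -/
def intertwiner : poly V ≃ₗ[ℂ] poly V :=
  (polyEquiv V).symm.trans <|
    (DFinsupp.mapRange.linearEquiv fun n => LinearEquiv.ofInjectiveEndo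
      (homogIntertwiner (R.positive β) k n) (homogIntertwiner_injective hβ hk hδ n)).trans <|
    polyEquiv V

theorem intertwiner_apply {n : ℕ} (p : homog V n) :
    intertwiner hβ hk hδ ⟨p, homog_le_poly n p.2⟩ =
      ⟨homogIntertwiner (R.positive β) k n p, homog_le_poly n (Subtype.property _)⟩ := by
  rw [← polyEquiv_single, intertwiner, LinearEquiv.trans_apply, LinearEquiv.symm_apply_apply,
    LinearEquiv.trans_apply, ← polyEquiv_single]
  exact congrArg _ (DFinsupp.mapRange_single (hf := fun _ => map_zero _))

theorem isDunklIntertwining_intertwiner :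
    IsDunklIntertwining (R.positive β) k (intertwiner hβ hk hδ) where
  map_homog n p hp := by
    have h := intertwiner_apply hβ hk hδ ⟨p, hp⟩
    rw [Subtype.coe_eta] at h
    rw [h]
    exact (homogIntertwiner (R.positive β) k n ⟨p, hp⟩).2
  map_one := intertwiner_apply (n := 0) hβ hk hδ
    ⟨fun _ => 1, ContinuousMultilinearMap.constOfIsEmpty ℝ _ 1, fun _ => rfl⟩
  intertwines ξ p := by
    induction p using poly_induction with
    | homogeneous n p hp =>
      rw [intertwiner_apply hβ hk hδ ⟨p, hp⟩]
      cases n with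
      | zero =>
        have h : polyDeriv ξ ⟨p, homog_le_poly 0 hp⟩ = 0 := by
          obtain ⟨c, rfl⟩ : ∃ c : ℂ, p = fun _ => c :=
            ⟨p 0, funext fun x => eq_of_mem_homog_zero hp x 0⟩
          exact Subtype.ext (funext fun x => by simp [polyDeriv, dirDeriv])
        rw [h, map_zero, dunklOp_of_mem_homog_zero _ _ (Subtype.property _)]
        rfl
      | succ n =>
        have h := intertwiner_apply hβ hk hδ (homogDeriv n ξ ⟨p, hp⟩)
        exact (dunklOp_homogIntertwiner hβ hk hδ ⟨p, hp⟩ ξ).trans (congrArg Subtype.val h).symm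
    | add p q hp hq =>
      rw [polyDeriv_add, map_add, map_add, Submodule.coe_add, Submodule.coe_add,
        dunklOp_add _ _ _ (differentiable_of_mem_poly (Subtype.property _))
          (differentiable_of_mem_poly (Subtype.property _)), hp, hq]

end Existence

/-! ### The formula for the intertwining operator -/

section Formula

omit [FiniteDimensional ℝ V] in
theorem iterDirDeriv_succ {n : ℕ} (ξ : Fin (n + 1) → V) (f : V → ℂ) :
    iterDirDeriv ξ f =
      iterDirDeriv (fun i : Fin n => ξ i.castSucc) (dirDeriv (ξ (Fin.last n)) f) := by
  rw [iterDirDeriv, List.ofFn_succ', List.concat_eq_append, List.foldr_append]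
  rfl

omit [FiniteDimensional ℝ V] in
-- With `g_i = h_i g` and `g_{n+1} = g`, the quotients `g_{i+1}⁻¹ g_i` are the conjugates `g⁻¹
-- (h_{i+1}⁻¹ h_i) g`, on which `C_i` takes the same value.
theorem multiC_snoc {R : ReducedRootSystem V} {β : V} (hβ : ∀ α ∈ R.roots, ⟪α, β⟫_ℝ ≠ 0)
    {k : V → ℂ} (hk : IsMultiplicity R k) {n : ℕ} (g : R.group) (h : Fin n → R.group) :
    multiC (R.positive β) k (fun i : Fin (n + 1) =>
        ((Fin.snoc (fun i => h i * g) g : Fin (n + 1) → R.group) i : V ≃ₗᵢ[ℝ] V)) =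
      bigC (R.positive β) k (n + 1) g *
        multiC (R.positive β) k (fun i => (h i : V ≃ₗᵢ[ℝ] V)) := by
  rw [multiC, Fin.prod_univ_castSucc, mul_comm, multiC]
  congr 1
  · simp
  · refine Finset.prod_congr rfl fun i _ => ?_
    rw [dif_pos (by simp)]
    -- The default `1` is the convention `h_{n+1} = e`, matching the final entry `g = e g`.
    set a : V ≃ₗᵢ[ℝ] V := if h' : (i : ℕ) + 1 < n then h ⟨i + 1, h'⟩ else 1 with ha
    have h1 : ((Fin.snoc (fun i => h i * g) g : Fin (n + 1) → R.group)
        ⟨(i.castSucc : ℕ) + 1, by simp⟩ : V ≃ₗᵢ[ℝ] V) = a * g := by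
      by_cases h' : (i : ℕ) + 1 < n <;> simp [Fin.snoc, ha, h']
    rw [h1, Fin.snoc_castSucc, ← bigC_conj hβ hk _ (inv_mem g.2) (a⁻¹ * h i)]
    congr 1

variable {R : ReducedRootSystem V} {β : V} (hβ : ∀ α ∈ R.roots, ⟪α, β⟫_ℝ ≠ 0) {k : V → ℂ}
  (hk : IsMultiplicity R k) (hδ : del (R.positive β) k < ‖1 + gam (R.positive β) k‖)
  {U : poly V ≃ₗ[ℂ] poly V} (hU : IsDunklIntertwining (R.positive β) k U)

include hδ hU

/-- The recursion forced on any intertwiner: apply the left inverse to `(n + 1 + γ) - A_{n+1}`,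
whose value on `U p` at `gx` is `T_{gx}(U p)(gx) = U(∂_{gx} p)(gx)`. -/
theorem IsDunklIntertwining.apply_succ {n : ℕ} {p : V → ℂ} (hp : p ∈ homog V (n + 1)) (x : V) :
    (U ⟨p, homog_le_poly _ hp⟩ : V → ℂ) x =
      ∑ g : R.group, bigC (R.positive β) k (n + 1) g *
        (U ⟨dirDeriv ((g : V ≃ₗᵢ[ℝ] V) x) p, homog_le_poly n (dirDeriv_mem_homog hp _)⟩ : V → ℂ)
          ((g : V ≃ₗᵢ[ℝ] V) x) := by
  let f : homog V (n + 1) := ⟨U ⟨p, homog_le_poly _ hp⟩, hU.map_homog _ _ hp⟩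
  have h1 := sum_bigC_smul_act_mul_shiftedA (del_lt_norm_natCast_add_gam hδ (Nat.le_add_left 1 n))
  have h2 := congrFun (congrArg Subtype.val (LinearMap.congr_fun h1 f)) x
  rw [Module.End.mul_apply, sum_smul_act_apply] at h2
  refine h2.symm.trans (Finset.sum_congr rfl fun g _ => ?_)
  rw [shiftedA_apply, ← dunklOp_self_of_mem_homog _ _ f.2]
  exact congrArg _ (congrFun (hU.intertwines _ _) _)

include hβ hk

theorem IsDunklIntertwining.apply_eq_sum {n : ℕ} {p : V → ℂ} (hp : p ∈ homog V n) (x y : V) :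
    (U ⟨p, homog_le_poly n hp⟩ : V → ℂ) x =
      ∑ g : Fin n → R.group,
        multiC (R.positive β) k (fun i => (g i : V ≃ₗᵢ[ℝ] V)) *
          iterDirDeriv (fun i => (g i : V ≃ₗᵢ[ℝ] V) x) p y := by
  induction n generalizing p x with
  | zero =>
    have h : (⟨p, homog_le_poly 0 hp⟩ : poly V) = p y • polyOne V :=
      Subtype.ext (funext fun x => by simp [polyOne, eq_of_mem_homog_zero hp x y])
    rw [h, map_smul, hU.map_one]
    simp [polyOne, multiC, iterDirDeriv]
  | succ n ih =>
    rw [hU.apply_succ hδ hp]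
    simp only [ih (dirDeriv_mem_homog hp _), Finset.mul_sum]
    rw [← Finset.sum_product']
    -- The inner formula is evaluated at `gx`, so its directions are `h_i (g x)`; hence `(g, h)` is
    -- sent to `(h_1 g, …, h_n g, g)`.
    let e : R.group × (Fin n → R.group) ≃ (Fin (n + 1) → R.group) :=
      (Equiv.prodShear (Equiv.refl _) fun g => Equiv.piCongrRight fun _ => Equiv.mulRight g).trans
        (Fin.snocEquiv fun _ => R.group)
    refine Fintype.sum_equiv e _ _ fun b => ?_
    have he : e b = Fin.snoc (fun i => b.2 i * b.1) b.1 := rfl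
    rw [he, multiC_snoc hβ hk, mul_assoc, iterDirDeriv_succ]
    simp only [Fin.snoc_castSucc, Fin.snoc_last]
    rfl

end Formula

end Dunkl

end

/-! ### The main theorem -/

theorem proposition3p1 {V : Type*} [NormedAddCommGroup V] [InnerProductSpace ℝ V]
    [FiniteDimensional ℝ V] (R : Dunkl.ReducedRootSystem V)
    (β : V) (hβ : ∀ α ∈ R.roots, inner ℝ α β ≠ 0)
    (k : V → ℂ) (hk : Dunkl.IsMultiplicity R k)
    (hδ : Dunkl.del (R.positive β) k < ‖1 + Dunkl.gam (R.positive β) k‖) :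
    -- the series defining `C_n(g)` converge absolutely
    (∀ n : ℕ, 1 ≤ n → ∀ g : R.group,
      Summable fun m => ‖Dunkl.cTerm (R.positive β) k n g m‖) ∧
    -- the resolvent `H_n` exists and equals `∑ C_n(g) g`
    (∀ n : ℕ, 1 ≤ n →
      IsUnit (Dunkl.shiftedA (R.positive β) k n) ∧
      Dunkl.resolventH (R.positive β) k n =
        ∑ g : R.group, Dunkl.bigC (R.positive β) k n g • Dunkl.act n (g : V ≃ₗᵢ[ℝ] V)) ∧
    -- the intertwining operator `V_k` is well defined
    (∃! U : Dunkl.poly V ≃ₗ[ℂ] Dunkl.poly V,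
      Dunkl.IsDunklIntertwining (R.positive β) k U) ∧
    -- its action on `𝒫_n`; the iterated derivative of `p` is a constant function, with
    -- the same value at every point `y`
    (∀ U : Dunkl.poly V ≃ₗ[ℂ] Dunkl.poly V,
      Dunkl.IsDunklIntertwining (R.positive β) k U →
      ∀ n : ℕ, 1 ≤ n → ∀ (p : V → ℂ) (hp : p ∈ Dunkl.homog V n) (x y : V),
        (U ⟨p, Dunkl.homog_le_poly n hp⟩ : V → ℂ) x =
          ∑ g : Fin n → R.group,
            Dunkl.multiC (R.positive β) k (fun i => (g i : V ≃ₗᵢ[ℝ] V)) *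
              Dunkl.iterDirDeriv (fun i => (g i : V ≃ₗᵢ[ℝ] V) x) p y) := by
  refine ⟨fun n hn g => Dunkl.summable_norm_cTerm (Dunkl.del_lt_norm_natCast_add_gam hδ hn) g,
    fun n hn => ⟨Dunkl.isUnit_shiftedA hβ hk (Dunkl.del_lt_norm_natCast_add_gam hδ hn),
      Dunkl.resolventH_eq_sum hβ hk (Dunkl.del_lt_norm_natCast_add_gam hδ hn)⟩,
    ⟨Dunkl.intertwiner hβ hk hδ, Dunkl.isDunklIntertwining_intertwiner hβ hk hδ,
      fun U hU => LinearEquiv.ext fun p => ?_⟩,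
    fun U hU n _ p hp x y => hU.apply_eq_sum hβ hk hδ hp x y⟩
  -- Uniqueness: the right-hand side of the explicit formula does not involve `U`.
  induction p using Dunkl.poly_induction with
  | homogeneous n p hp =>
    refine Subtype.ext (funext fun x => ?_)
    rw [hU.apply_eq_sum hβ hk hδ hp x 0,
      (Dunkl.isDunklIntertwining_intertwiner hβ hk hδ).apply_eq_sum hβ hk hδ hp x 0]
  | add p q hp hq => rw [map_add, map_add, hp, hq]
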